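/- Let $\mathbb{T}=\mathbb{R}^2/2\pi\mathbb{Z}^2$ be the flat torus, let $\alpha,\beta\in\mathbb{R}$ with $\beta\neq 0$ and $\alpha/\beta$ irrational, and let $\psi_t(x,y)=(x+\alpha t,\,y+\beta t)$, $t\in\mathbb{R}$, be the corresponding irrational winding on $\mathbb{T}$. For a smooth function $G:\mathbb{T}\to\mathbb{R}$, an integer $N>0$ and a real $\tau>0$, the Takens (delay) map $\Psi_\tau^N:\mathbb{T}\to\mathbb{R}^{N+1}$ is $$\Psi_\tau^N(p)=\big(G(p),\,G(\psi_\tau(p)),\,G(\psi_{2\tau}(p)),\,\ldots,\,G(\psi_{N\tau}(p))\big),$$ and $G$ is called a good observation for the winding if $\Psi_\tau^N$ is a smooth embedding for some $N>0$ and some $\tau>0$. Let $$\hat G(n,m)=\frac{1}{(2\pi)^2}\int_0^{2\pi}\!\!\int_0^{2\pi}G(x,y)\,e^{-i(nx+my)}\,dy\,dx,\qquad (n,m)\in\mathbb{Z}^2,$$ be the Fourier coefficients of $G$, and let $\operatorname{Supp}\hat G=\{(n,m)\in\mathbb{Z}^2 : \hat G(n,m)\neq 0\}$. Then a smooth function $G:\mathbb{T}\to\mathbb{R}$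 is a good observation for the irrational winding $\psi_t$ if and only if $\operatorname{Supp}\hat G$ generates $\mathbb{Z}^2$ as an abelian group. -/

import Mathlib

open scoped Manifold ContDiff

noncomputable section

/-- A smooth embedding between (finite-dimensional) smooth manifolds: a smooth map whose
differential is injective at every point (an immersion) and which is a homeomorphism onto its
image. -/
structure IsSmoothEmb {E H M E' H' M' : Type*}
    [NormedAddCommGroup E] [NormedSpace ℝ E] [TopologicalSpace H]
    (I : ModelWithCorners ℝ E H) [TopologicalSpace M] [ChartedSpace H M]
    [NormedAddCommGroup E'] [NormedSpace ℝ E'] [TopologicalSpace H']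
    (I' : ModelWithCorners ℝ E' H') [TopologicalSpace M'] [ChartedSpace H' M']
    (f : M → M') : Prop where
  contMDiff : ContMDiff I I' ∞ f
  injective_mfderiv : ∀ p : M, Function.Injective (mfderiv I I' f p)
  isEmbedding : Topology.IsEmbedding f

/-- The Takens (delay coordinate) map
`p ↦ (G p, G (ψ_τ p), G (ψ_{2τ} p), …, G (ψ_{Nτ} p)) ∈ ℝ^{N+1}`. -/
def takensMap {M : Type*} (ψ : ℝ → M → M) (G : M → ℝ) (τ : ℝ) (N : ℕ) :
    M → EuclideanSpace ℝ (Fin (N + 1)) :=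
  fun p => WithLp.toLp 2 fun k => G (ψ ((k : ℕ) * τ) p)

/-- `G` is a good observation for the flow `ψ` if the Takens map is an embedding for some
number of delays `N > 0` and some flow time `τ > 0`. -/
def IsGoodObservation {E H M : Type*} [NormedAddCommGroup E] [NormedSpace ℝ E]
    [TopologicalSpace H] (I : ModelWithCorners ℝ E H) [TopologicalSpace M] [ChartedSpace H M]
    (ψ : ℝ → M → M) (G : M → ℝ) : Prop :=
  ∃ (N : ℕ) (τ : ℝ), 0 < N ∧ 0 < τ ∧
    IsSmoothEmb I 𝓘(ℝ, EuclideanSpace ℝ (Fin (N + 1))) (takensMap ψ G τ N)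

/-- The torus `𝕋 = S¹ × S¹`, with Mathlib's smooth structure on the unit circle. The angular
coordinates `(x, y) ∈ ℝ² / 2πℤ²` correspond to the point `(e^{ix}, e^{iy})`. -/
abbrev Torus : Type := Circle × Circle

/-- The model with corners of the torus. -/
abbrev torusModel := (𝓡 1).prod (𝓡 1)

/-- The linear flow `ψ_t (x, y) = (x + α t, y + β t)` in angular coordinates. -/
def windingFlow (α β : ℝ) (t : ℝ) (p : Torus) : Torus :=
  (p.1 * Circle.exp (α * t), p.2 * Circle.exp (β * t))

/-- The Fourier coefficient
`Ĝ(n, m) = (2π)⁻² ∫₀^{2π} ∫₀^{2π} G(x, y) e^{-i(nx + my)} dy dx`. -/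
def torusFourierCoeff (G : Torus → ℝ) (k : ℤ × ℤ) : ℂ :=
  (1 / (2 * Real.pi) ^ 2 : ℂ) * ∫ x in (0 : ℝ)..(2 * Real.pi), ∫ y in (0 : ℝ)..(2 * Real.pi),
    (G (Circle.exp x, Circle.exp y) : ℂ) * Complex.exp (-(Complex.I * (k.1 * x + k.2 * y)))

/-- The support of the Fourier coefficients of `G`. -/
def fourierSupport (G : Torus → ℝ) : Set (ℤ × ℤ) :=
  {k | torusFourierCoeff G k ≠ 0}

end

/-! Necessity: if the support generates a proper subgroup, some `h ≠ 1` in the torus is killed by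
every character in it. The Fourier series then makes `G` invariant under translation by `h`.
Translations commute with the flow, so the Takens map takes equal values at `h` and `1`.

Sufficiency: irrationality allows a `τ` for which no nonzero mode is resonant. Averaging the delay
coordinates against powers of `e^{-iτω_k}`, with `ω_k` the frequency of mode `k`, isolates `Ĝ(k)
χ_k` as `N → ∞`. The average is 1-Lipschitz in the Takens vector, and the Lipschitz constant of the
remaining modes tends to 0 because `∑ |l| |Ĝ(l)|` converges (`norm_torusFourierCoeff_mul_dist_le`).
Hence differences of `χ_k`, for `k` in the support, are bounded by a multiple of the Takens
difference plus `ε · dist p q`. Such bounds survive products and inverses of characters, so they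
reach both coordinates. Absorbing the `ε` term gives `dist p q ≤ C ‖Ψ p - Ψ q‖`, which yields
injectivity and immersion together; compactness does the rest. -/

open Filter Topology MeasureTheory

/-! ### Characters of the torus -/

/-- The character `(x, y) ↦ e^{i (n x + m y)}` of the torus. -/
noncomputable def torusChar (k : ℤ × ℤ) (p : Torus) : Circle := p.1 ^ k.1 * p.2 ^ k.2

lemma torusChar_add (k l : ℤ × ℤ) (p : Torus) :
    torusChar (k + l) p = torusChar k p * torusChar l p := by
  simp only [torusChar, Prod.fst_add, Prod.snd_add, zpow_add]
  exact mul_mul_mul_comm _ _ _ _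

lemma torusChar_neg (k : ℤ × ℤ) (p : Torus) : torusChar (-k) p = (torusChar k p)⁻¹ := by
  simp [torusChar, zpow_neg, mul_comm]

lemma torusChar_zero (p : Torus) : torusChar 0 p = 1 := by simp [torusChar]

lemma torusChar_mul (k : ℤ × ℤ) (p q : Torus) :
    torusChar k (p * q) = torusChar k p * torusChar k q := by
  simp only [torusChar, Prod.fst_mul, Prod.snd_mul, mul_zpow]
  exact mul_mul_mul_comm _ _ _ _

lemma torusChar_exp (k : ℤ × ℤ) (x y : ℝ) :
    torusChar k (Circle.exp x, Circle.exp y) = Circle.exp (k.1 * x + k.2 * y) := by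
  simp [torusChar, Circle.exp_add]

lemma Circle.dist_eq_norm_sub (z w : Circle) : dist z w = ‖(z : ℂ) - w‖ := by
  rw [← _root_.dist_eq_norm]; rfl

lemma Circle.dist_mul_left (a z w : Circle) : dist (a * z) (a * w) = dist z w := by
  simp [Circle.dist_eq_norm_sub, ← mul_sub, Circle.norm_coe]

lemma Circle.dist_mul_right (a z w : Circle) : dist (z * a) (w * a) = dist z w := by
  rw [mul_comm z, mul_comm w, Circle.dist_mul_left]

lemma Circle.dist_mul_mul_le (a b c d : Circle) : dist (a * b) (c * d) ≤ dist a c + dist b d :=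
  (dist_triangle _ (c * b) _).trans_eq (by rw [Circle.dist_mul_left, Circle.dist_mul_right])

lemma Circle.dist_inv_inv (z w : Circle) : dist z⁻¹ w⁻¹ = dist z w := by
  rw [← Circle.dist_mul_left (z * w), dist_comm]
  congr 1
  · simp [mul_assoc]
  · simp [mul_comm z w]

lemma Circle.dist_pow_pow_le (z w : Circle) (n : ℕ) : dist (z ^ n) (w ^ n) ≤ n * dist z w := by
  induction n with
  | zero => simp
  | succ n ih =>
    rw [pow_succ, pow_succ]
    refine (Circle.dist_mul_mul_le _ _ _ _).trans ?_
    push_cast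
    linarith

lemma Circle.dist_zpow_zpow_le (z w : Circle) (n : ℤ) : dist (z ^ n) (w ^ n) ≤ |n| * dist z w := by
  obtain ⟨m, rfl | rfl⟩ := n.eq_nat_or_neg
  · simpa using Circle.dist_pow_pow_le z w m
  · simpa [Circle.dist_inv_inv] using Circle.dist_pow_pow_le z w m

/-- The linear growth in `k` is why weighted summability of the Fourier coefficients is needed
later. -/
lemma dist_torusChar_le (k : ℤ × ℤ) (p q : Torus) :
    dist (torusChar k p) (torusChar k q) ≤ (|(k.1 : ℝ)| + |(k.2 : ℝ)|) * dist p q := by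
  refine (Circle.dist_mul_mul_le _ _ _ _).trans ?_
  have h1 := Circle.dist_zpow_zpow_le p.1 q.1 k.1
  have h2 := Circle.dist_zpow_zpow_le p.2 q.2 k.2
  have h3 : dist p.1 q.1 ≤ dist p q := le_max_left _ _
  have h4 : dist p.2 q.2 ≤ dist p q := le_max_right _ _
  have h5 := mul_le_mul_of_nonneg_left h3 (abs_nonneg (k.1 : ℝ))
  have h6 := mul_le_mul_of_nonneg_left h4 (abs_nonneg (k.2 : ℝ))
  push_cast at h1 h2
  linarith

/-! ### Fourier coefficients of smooth doubly periodic functions -/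

/-- A smooth function on the plane that is `2π`-periodic in both variables. -/
structure SmoothDoublyPeriodic (g : ℝ × ℝ → ℂ) : Prop where
  contDiff : ContDiff ℝ ∞ g
  periodic : ∀ p : ℝ × ℝ, g (p + (2 * Real.pi, 0)) = g p ∧ g (p + (0, 2 * Real.pi)) = g p

/-- The unnormalised Fourier coefficient of a doubly periodic function. -/
noncomputable def planeCoeff (g : ℝ × ℝ → ℂ) (k : ℤ × ℤ) : ℂ :=
  ∫ x in (0 : ℝ)..(2 * Real.pi), ∫ y in (0 : ℝ)..(2 * Real.pi),
    g (x, y) * Complex.exp (-(Complex.I * (k.1 * x + k.2 * y)))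

/-- The differential operator `1 + ∂_v`. -/
noncomputable def addLineDeriv (v : ℝ × ℝ) (g : ℝ × ℝ → ℂ) : ℝ × ℝ → ℂ :=
  fun p => g p + fderiv ℝ g p v

lemma SmoothDoublyPeriodic.addLineDeriv {g : ℝ × ℝ → ℂ} (hg : SmoothDoublyPeriodic g)
    (v : ℝ × ℝ) : SmoothDoublyPeriodic (addLineDeriv v g) := by
  refine ⟨hg.contDiff.add ((hg.contDiff.fderiv_right (m := ∞) (by simp)).clm_apply
    contDiff_const), fun p => ?_⟩
  have key (a : ℝ × ℝ) (ha : ∀ p, g (p + a) = g p) :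
      _root_.addLineDeriv v g (p + a) = _root_.addLineDeriv v g p := by
    have : (fun p => g (p + a)) = g := funext ha
    simp only [_root_.addLineDeriv, ha]
    rw [← fderiv_comp_add_right, this]
  exact ⟨key _ fun p => (hg.periodic p).1, key _ fun p => (hg.periodic p).2⟩

/-- Integration by parts, with boundary terms cancelling by periodicity. Using `1 + ∂` rather than
`∂` makes the factor `1 + in` nonzero for every `n`, so the zero mode needs no separate case. -/
lemma integral_add_deriv_mul_exp {h h' : ℝ → ℂ} (hd : ∀ x, HasDerivAt h (h' x) x)
    (hc : Continuous h') (hp : h (2 * Real.pi) = h 0) (n : ℤ) (c : ℂ) :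
    ∫ x in (0 : ℝ)..(2 * Real.pi), (h x + h' x) * Complex.exp (-(Complex.I * (n * x + c))) =
      (1 + Complex.I * n) * ∫ x in (0 : ℝ)..(2 * Real.pi),
        h x * Complex.exp (-(Complex.I * (n * x + c))) := by
  have hhc : Continuous h := continuous_iff_continuousAt.2 fun x => (hd x).continuousAt
  set e : ℝ → ℂ := fun x => Complex.exp (-(Complex.I * (n * x + c))) with he
  have hed (x : ℝ) : HasDerivAt e (e x * (-(Complex.I * n))) x := by
    refine HasDerivAt.cexp ?_
    have h0 : HasDerivAt (fun x : ℝ => (x : ℂ)) 1 x := Complex.ofRealCLM.hasDerivAt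
    have h1 := (((h0.const_mul (n : ℂ)).add_const c).const_mul Complex.I).fun_neg
    rwa [mul_one] at h1
  have hec : Continuous e := continuous_iff_continuousAt.2 fun x => (hed x).continuousAt
  have hee : e (2 * Real.pi) = e 0 := by
    simp only [he]
    rw [Complex.exp_eq_exp_iff_exists_int]
    exact ⟨-n, by push_cast; ring⟩
  have h1 : ∫ x in (0 : ℝ)..(2 * Real.pi), (h' x * e x + h x * (e x * (-(Complex.I * n)))) = 0 := by
    rw [intervalIntegral.integral_eq_sub_of_hasDerivAt (f := fun x => h x * e x)
      (fun x _ => (hd x).mul (hed x)) (by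
        apply Continuous.intervalIntegrable; fun_prop)]
    simp [hp, hee]
  rw [← intervalIntegral.integral_const_mul, ← sub_eq_zero, ← intervalIntegral.integral_sub, ← h1]
  · congr 1; ext x; ring
  all_goals apply Continuous.intervalIntegrable; fun_prop

lemma SmoothDoublyPeriodic.continuous_integrand {g : ℝ × ℝ → ℂ} (hg : SmoothDoublyPeriodic g)
    (k : ℤ × ℤ) : Continuous fun p : ℝ × ℝ =>
      g p * Complex.exp (-(Complex.I * (k.1 * p.1 + k.2 * p.2))) := by
  have := hg.contDiff.continuous
  fun_prop

lemma SmoothDoublyPeriodic.planeCoeff_snd {g : ℝ × ℝ → ℂ} (hg : SmoothDoublyPeriodic g)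
    (k : ℤ × ℤ) :
    planeCoeff (_root_.addLineDeriv (0, 1) g) k = (1 + Complex.I * k.2) * planeCoeff g k := by
  unfold planeCoeff
  rw [← intervalIntegral.integral_const_mul]
  congr 1
  ext x
  have hdiff := hg.contDiff.differentiable (by simp)
  have hcf : Continuous (fderiv ℝ g) := hg.contDiff.continuous_fderiv (by simp)
  have := integral_add_deriv_mul_exp (h := fun y => g (x, y))
    (h' := fun y => fderiv ℝ g (x, y) (0, 1)) (fun y => ?_) (by fun_prop)
    (by simpa using (hg.periodic (x, 0)).2) k.2 (k.1 * x)
  · simpa only [_root_.addLineDeriv, add_comm] using this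
  · exact (hdiff (x, y)).hasFDerivAt.comp_hasDerivAt y ((hasDerivAt_const y x).prodMk (hasDerivAt_id y))

/-- Puts the `x`-integral inside, ready for integration by parts in `x`. -/
lemma SmoothDoublyPeriodic.planeCoeff_swap {g : ℝ × ℝ → ℂ} (hg : SmoothDoublyPeriodic g)
    (k : ℤ × ℤ) : planeCoeff g k =
      ∫ y in (0 : ℝ)..(2 * Real.pi), ∫ x in (0 : ℝ)..(2 * Real.pi),
        g (x, y) * Complex.exp (-(Complex.I * (k.1 * x + k.2 * y))) := by
  unfold planeCoeff
  rw [intervalIntegral_intervalIntegral_swap]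
  refine ((hg.continuous_integrand k).continuousOn.integrableOn_compact
    (isCompact_uIcc.prod isCompact_uIcc)).mono_set
    (Set.prod_mono Set.uIoc_subset_uIcc Set.uIoc_subset_uIcc)

lemma SmoothDoublyPeriodic.planeCoeff_fst {g : ℝ × ℝ → ℂ} (hg : SmoothDoublyPeriodic g)
    (k : ℤ × ℤ) :
    planeCoeff (_root_.addLineDeriv (1, 0) g) k = (1 + Complex.I * k.1) * planeCoeff g k := by
  rw [hg.planeCoeff_swap, (hg.addLineDeriv _).planeCoeff_swap,
    ← intervalIntegral.integral_const_mul]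
  congr 1
  ext y
  have hdiff := hg.contDiff.differentiable (by simp)
  have hcf : Continuous (fderiv ℝ g) := hg.contDiff.continuous_fderiv (by simp)
  exact integral_add_deriv_mul_exp (h := fun x => g (x, y))
    (h' := fun x => fderiv ℝ g (x, y) (1, 0))
    (fun x => (hdiff (x, y)).hasFDerivAt.comp_hasDerivAt x
      ((hasDerivAt_id x).prodMk (hasDerivAt_const x y))) (by fun_prop)
    (by simpa using (hg.periodic (0, y)).1) k.1 (k.2 * y)

lemma norm_exp_neg_I_mul (a b x y : ℝ) :
    ‖Complex.exp (-(Complex.I * (a * x + b * y)))‖ = 1 := by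
  rw [Complex.norm_exp]; simp

lemma SmoothDoublyPeriodic.exists_bound {g : ℝ × ℝ → ℂ} (hg : SmoothDoublyPeriodic g) :
    ∃ C, ∀ k, ‖planeCoeff g k‖ ≤ C := by
  obtain ⟨C, hC⟩ := (isCompact_uIcc (a := (0 : ℝ)) (b := 2 * Real.pi)).prod
    (isCompact_uIcc (a := (0 : ℝ)) (b := 2 * Real.pi)) |>.exists_bound_of_continuousOn
    hg.contDiff.continuous.continuousOn
  refine ⟨C * |2 * Real.pi - 0| * |2 * Real.pi - 0|, fun k => ?_⟩
  refine intervalIntegral.norm_integral_le_of_norm_le_const fun x hx => ?_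
  refine intervalIntegral.norm_integral_le_of_norm_le_const (C := C) fun y hy => ?_
  have := norm_exp_neg_I_mul k.1 k.2 x y
  push_cast at this
  rw [norm_mul, this, mul_one]
  exact hC (x, y) ⟨Set.uIoc_subset_uIcc hx, Set.uIoc_subset_uIcc hy⟩

/-- Of the three factors in each variable, one pays for the weight `1 + |n|` and two give the
summable `(1 + n²)⁻¹`. -/
lemma SmoothDoublyPeriodic.exists_decay {g : ℝ × ℝ → ℂ} (hg : SmoothDoublyPeriodic g) :
    ∃ C, ∀ k : ℤ × ℤ, (‖1 + Complex.I * k.1‖ * ‖1 + Complex.I * k.2‖) ^ 3 *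
      ‖planeCoeff g k‖ ≤ C := by
  have h1 := hg.addLineDeriv (1, 0)
  have h2 := h1.addLineDeriv (1, 0)
  have h3 := h2.addLineDeriv (1, 0)
  have h4 := h3.addLineDeriv (0, 1)
  have h5 := h4.addLineDeriv (0, 1)
  have h6 := h5.addLineDeriv (0, 1)
  obtain ⟨C, hC⟩ := h6.exists_bound
  refine ⟨C, fun k => le_of_eq_of_le ?_ (hC k)⟩
  rw [h5.planeCoeff_snd, h4.planeCoeff_snd, h3.planeCoeff_snd, h2.planeCoeff_fst,
    h1.planeCoeff_fst, hg.planeCoeff_fst]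
  simp only [norm_mul]
  ring

lemma sq_norm_one_add_I_mul (n : ℤ) : ‖1 + Complex.I * n‖ ^ 2 = 1 + (n : ℝ) ^ 2 := by
  rw [← Complex.normSq_eq_norm_sq, Complex.normSq_apply]
  simp
  ring

lemma one_add_abs_le (n : ℤ) : 1 + |(n : ℝ)| ≤ 2 * ‖1 + Complex.I * n‖ := by
  have h := sq_norm_one_add_I_mul n
  have h2 := norm_nonneg (1 + Complex.I * n)
  rw [← sq_abs (n : ℝ)] at h
  nlinarith [sq_nonneg (1 - |(n : ℝ)|), abs_nonneg (n : ℝ)]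

lemma summable_one_add_int_sq_inv : Summable fun n : ℤ => (1 + (n : ℝ) ^ 2)⁻¹ := by
  have h := (Real.summable_one_div_int_pow (p := 2)).2 (by norm_num)
  -- Since `1 / 0 ^ 2 = 0` by convention, a unit mass at `0` is added to dominate the term `n = 0`.
  refine Summable.of_nonneg_of_le (fun n => by positivity) (fun n => ?_)
    (h.add (hasSum_pi_single (0 : ℤ) (1 : ℝ)).summable)
  obtain rfl | hn := eq_or_ne n 0
  · simp
  · rw [Pi.single_eq_of_ne hn, add_zero, one_div]
    have : (0 : ℝ) < (n : ℝ) ^ 2 := by positivity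
    gcongr
    linarith

lemma SmoothDoublyPeriodic.summable {g : ℝ × ℝ → ℂ} (hg : SmoothDoublyPeriodic g) :
    Summable fun k : ℤ × ℤ => (1 + |(k.1 : ℝ)|) * (1 + |(k.2 : ℝ)|) * ‖planeCoeff g k‖ := by
  obtain ⟨C, hC⟩ := hg.exists_decay
  have hs := (summable_one_add_int_sq_inv.mul_of_nonneg summable_one_add_int_sq_inv
    (fun n => by positivity) (fun n => by positivity)).mul_left (4 * C)
  refine Summable.of_nonneg_of_le (fun k => by positivity) (fun k => ?_) hs
  have ha := one_add_abs_le k.1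
  have hb := one_add_abs_le k.2
  have ha2 := sq_norm_one_add_I_mul k.1
  have hb2 := sq_norm_one_add_I_mul k.2
  have hk := hC k
  rw [← mul_inv, ← div_eq_mul_inv, le_div_iff₀ (by positivity), ← ha2, ← hb2]
  calc _ ≤ (2 * ‖1 + Complex.I * k.1‖) * (2 * ‖1 + Complex.I * k.2‖) * ‖planeCoeff g k‖ *
      (‖1 + Complex.I * k.1‖ ^ 2 * ‖1 + Complex.I * k.2‖ ^ 2) := by gcongr
    _ = 4 * ((‖1 + Complex.I * k.1‖ * ‖1 + Complex.I * k.2‖) ^ 3 * ‖planeCoeff g k‖) := by ring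
    _ ≤ 4 * C := by gcongr

/-! ### Fourier series on the torus -/

/-- The map `(x, y) ↦ p · (e^{ix}, e^{iy})`. -/
noncomputable def torusExp (p : Torus) (w : ℝ × ℝ) : Torus :=
  (p.1 * Circle.exp w.1, p.2 * Circle.exp w.2)

lemma contMDiff_torusExp (p : Torus) : ContMDiff 𝓘(ℝ, ℝ × ℝ) torusModel ∞ (torusExp p) := by
  have h1 : ContMDiff 𝓘(ℝ, ℝ × ℝ) 𝓘(ℝ, ℝ) ∞ (Prod.fst : ℝ × ℝ → ℝ) := contDiff_fst.contMDiff
  have h2 : ContMDiff 𝓘(ℝ, ℝ × ℝ) 𝓘(ℝ, ℝ) ∞ (Prod.snd : ℝ × ℝ → ℝ) := contDiff_snd.contMDiff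
  exact (contMDiff_mul_left.comp (contMDiff_circleExp.comp h1)).prodMk
    (contMDiff_mul_left.comp (contMDiff_circleExp.comp h2))

lemma smoothDoublyPeriodic_of_contMDiff {G : Torus → ℝ} (hG : ContMDiff torusModel 𝓘(ℝ, ℝ) ∞ G) :
    SmoothDoublyPeriodic fun w => (G (Circle.exp w.1, Circle.exp w.2) : ℂ) := by
  constructor
  · have h : ContDiff ℝ ∞ fun w : ℝ × ℝ => G (Circle.exp w.1, Circle.exp w.2) := by
      have := (hG.comp (contMDiff_torusExp 1)).contDiff
      simpa [Function.comp_def, torusExp] using this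
    exact Complex.ofRealCLM.contDiff.comp h
  · intro p
    simp [Circle.exp_add]

lemma torusFourierCoeff_eq (G : Torus → ℝ) (k : ℤ × ℤ) :
    torusFourierCoeff G k = (1 / (2 * Real.pi) ^ 2 : ℂ) *
      planeCoeff (fun w => (G (Circle.exp w.1, Circle.exp w.2) : ℂ)) k := rfl

lemma summable_torusFourierCoeff {G : Torus → ℝ} (hG : ContMDiff torusModel 𝓘(ℝ, ℝ) ∞ G) :
    Summable fun k : ℤ × ℤ =>
      (1 + |(k.1 : ℝ)|) * (1 + |(k.2 : ℝ)|) * ‖torusFourierCoeff G k‖ := by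
  refine ((smoothDoublyPeriodic_of_contMDiff hG).summable.mul_left
    ‖(1 / (2 * Real.pi) ^ 2 : ℂ)‖).congr fun k => ?_
  rw [torusFourierCoeff_eq, norm_mul]
  ring

lemma summable_norm_torusFourierCoeff {G : Torus → ℝ}
    (hG : ContMDiff torusModel 𝓘(ℝ, ℝ) ∞ G) : Summable fun k => ‖torusFourierCoeff G k‖ := by
  refine Summable.of_nonneg_of_le (fun k => norm_nonneg _) (fun k => ?_)
    (summable_torusFourierCoeff hG)
  have h1 := abs_nonneg (k.1 : ℝ)
  have h2 := abs_nonneg (k.2 : ℝ)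
  have h3 := norm_nonneg (torusFourierCoeff G k)
  nlinarith [mul_nonneg h1 h2]

/-- Matches coefficients over the unit cube with the `2π`-normalised iterated integral. The form `0
+ 1` comes from the base point `0` in `UnitAddTorus.mFourierCoeff_eq_integral`. -/
lemma integral_unit_square_eq (φ : ℝ × ℝ → ℂ) (hφ : Continuous φ) :
    ∫ x in {x : Fin 2 → ℝ | ∀ i, x i ∈ Set.Ioc (0 : ℝ) (0 + 1)},
      φ (2 * Real.pi * x 0, 2 * Real.pi * x 1) =
    (1 / (2 * Real.pi) ^ 2 : ℂ) *
      ∫ x in (0 : ℝ)..(2 * Real.pi), ∫ y in (0 : ℝ)..(2 * Real.pi), φ (x, y) := by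
  have hpi : (2 * Real.pi) ≠ 0 := by positivity
  have hset : {x : Fin 2 → ℝ | ∀ i, x i ∈ Set.Ioc (0 : ℝ) (0 + 1)} =
      MeasurableEquiv.finTwoArrow ⁻¹' (Set.Ioc (0 : ℝ) 1 ×ˢ Set.Ioc (0 : ℝ) 1) := by
    ext x
    simp [Fin.forall_fin_two, MeasurableEquiv.finTwoArrow]
  rw [hset]
  have h1 := (volume_preserving_finTwoArrow ℝ).setIntegral_preimage_emb
    MeasurableEquiv.finTwoArrow.measurableEmbedding
    (fun p : ℝ × ℝ => φ (2 * Real.pi * p.1, 2 * Real.pi * p.2)) (Set.Ioc (0 : ℝ) 1 ×ˢ Set.Ioc (0 : ℝ) 1)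
  refine h1.trans ?_
  rw [Measure.volume_eq_prod, setIntegral_prod]
  · have h2 (x : ℝ) : ∫ y in Set.Ioc (0 : ℝ) 1, φ (2 * Real.pi * x, 2 * Real.pi * y) =
        (2 * Real.pi)⁻¹ • ∫ y in (0 : ℝ)..(2 * Real.pi), φ (2 * Real.pi * x, y) := by
      rw [← intervalIntegral.integral_of_le zero_le_one,
        intervalIntegral.integral_comp_mul_left (fun y => φ (2 * Real.pi * x, y)) hpi]
      simp
    simp only [h2]
    rw [← intervalIntegral.integral_of_le zero_le_one, intervalIntegral.integral_smul,
      intervalIntegral.integral_comp_mul_left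
        (fun x => ∫ y in (0 : ℝ)..(2 * Real.pi), φ (x, y)) hpi, smul_smul]
    simp only [mul_zero, mul_one, Complex.real_smul]
    congr 1
    push_cast
    field_simp
  · have hc : Continuous fun p : ℝ × ℝ => φ (2 * Real.pi * p.1, 2 * Real.pi * p.2) := by fun_prop
    exact (hc.continuousOn.integrableOn_compact (isCompact_Icc.prod isCompact_Icc)).mono_set
      (Set.prod_mono Set.Ioc_subset_Icc_self Set.Ioc_subset_Icc_self)

/-- Summable coefficients of a continuous function make its Fourier series converge to it at every
point; the result is transported from `UnitAddTorus (Fin 2)`. -/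
lemma hasSum_torusFourierCoeff {G : Torus → ℝ} (hG : ContMDiff torusModel 𝓘(ℝ, ℝ) ∞ G)
    (p : Torus) :
    HasSum (fun k => torusFourierCoeff G k * (torusChar k p : ℂ)) (G p) := by
  let F : C(UnitAddTorus (Fin 2), ℂ) :=
    ⟨fun z => (G (AddCircle.toCircle (z 0), AddCircle.toCircle (z 1)) : ℂ), by
      have := hG.continuous
      have := AddCircle.continuous_toCircle (T := (1 : ℝ))
      fun_prop⟩
  have hcoeff (n : Fin 2 → ℤ) :
      UnitAddTorus.mFourierCoeff F n = torusFourierCoeff G (n 0, n 1) := by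
    rw [UnitAddTorus.mFourierCoeff_eq_integral _ _ 0, torusFourierCoeff,
      ← integral_unit_square_eq (fun w => (G (Circle.exp w.1, Circle.exp w.2) : ℂ) *
        Complex.exp (-(Complex.I * (n 0 * w.1 + n 1 * w.2))))
        ((smoothDoublyPeriodic_of_contMDiff hG).continuous_integrand (n 0, n 1))]
    congr 1
    ext x
    simp only [F, UnitAddTorus.mFourier, ContinuousMap.coe_mk, Fin.prod_univ_two, Pi.neg_apply,
      fourier_coe_apply, smul_eq_mul, AddCircle.toCircle_apply_mk, ← Complex.exp_add]
    rw [mul_comm]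
    congr 2
    · simp
    · push_cast
      ring
  have hsum : Summable (UnitAddTorus.mFourierCoeff F) := by
    have := ((finTwoArrowEquiv ℤ).summable_iff).2 (summable_norm_torusFourierCoeff hG).of_norm
    refine this.congr fun n => ?_
    rw [hcoeff]
    rfl
  obtain ⟨x, hx⟩ := (AddCircle.homeomorphCircle one_ne_zero).surjective p.1
  obtain ⟨y, hy⟩ := (AddCircle.homeomorphCircle one_ne_zero).surjective p.2
  have h := UnitAddTorus.hasSum_mFourier_series_apply_of_summable hsum ![x, y]
  rw [AddCircle.homeomorphCircle_apply] at hx hy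
  rw [← (finTwoArrowEquiv ℤ).hasSum_iff]
  convert h using 1
  · ext n
    simp [hcoeff, UnitAddTorus.mFourier, torusChar, fourier_apply, AddCircle.toCircle_zsmul, hx, hy]
  · simp [F, hx, hy]

/-! ### A good observation has generating Fourier support -/

/-- Characters with values in `ℚ/ℤ` separate points of `ℤ² / H`. Lifting the values of one on the
two basis classes to rationals `r`, `s` gives the torus point `(2πr, 2πs)`, where `χ_k = 1` exactly
when the character kills `k`. -/
lemma exists_torusChar_eq_one {H : AddSubgroup (ℤ × ℤ)} (hH : H ≠ ⊤) :
    ∃ h : Torus, h ≠ 1 ∧ ∀ k ∈ H, torusChar k h = 1 := by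
  obtain ⟨a, ha⟩ : ∃ a, a ∉ H := by
    by_contra! h
    exact hH ((AddSubgroup.eq_top_iff' H).2 h)
  obtain ⟨c, hc⟩ := CharacterModule.exists_character_apply_ne_zero_of_ne_zero
    (mt (QuotientAddGroup.eq_zero_iff a).1 ha)
  obtain ⟨r, hr⟩ := QuotientAddGroup.mk_surjective (c ((1, 0) : ℤ × ℤ))
  obtain ⟨s, hs⟩ := QuotientAddGroup.mk_surjective (c ((0, 1) : ℤ × ℤ))
  have hck (k : ℤ × ℤ) : c (k : ℤ × ℤ) = ((k.1 * r + k.2 * s : ℚ) : AddCircle (1 : ℚ)) := by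
    have hk : (k : (ℤ × ℤ) ⧸ H) =
        k.1 • (((1, 0) : ℤ × ℤ) : (ℤ × ℤ) ⧸ H) + k.2 • (((0, 1) : ℤ × ℤ) : (ℤ × ℤ) ⧸ H) := by
      rw [← QuotientAddGroup.mk_zsmul, ← QuotientAddGroup.mk_zsmul, ← QuotientAddGroup.mk_add]
      simp
    rw [hk, map_add, map_zsmul, map_zsmul, ← hr, ← hs]
    rw [← QuotientAddGroup.mk_zsmul, ← QuotientAddGroup.mk_zsmul, ← QuotientAddGroup.mk_add]
    simp
  have hiff (k : ℤ × ℤ) : torusChar k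
      (Circle.exp (2 * Real.pi * r), Circle.exp (2 * Real.pi * s)) = 1 ↔ c (k : ℤ × ℤ) = 0 := by
    rw [torusChar_exp, Circle.exp_eq_one, hck, AddCircle.coe_eq_zero_iff]
    refine exists_congr fun n => ?_
    have hpi : (2 * Real.pi) ≠ 0 := by positivity
    rw [show (k.1 : ℝ) * (2 * Real.pi * r) + k.2 * (2 * Real.pi * s) =
      (k.1 * r + k.2 * s) * (2 * Real.pi) by ring, mul_left_inj' hpi, zsmul_one]
    constructor
    · intro h
      exact_mod_cast h.symm
    · intro h
      exact_mod_cast h.symm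
  refine ⟨(Circle.exp (2 * Real.pi * r), Circle.exp (2 * Real.pi * s)), fun h => hc ?_,
    fun k hk => ?_⟩
  · rw [← hiff, h]
    simp [torusChar]
  · rw [hiff, (QuotientAddGroup.eq_zero_iff k).2 hk, map_zero]

lemma apply_mul_eq_of_torusChar_eq_one {G : Torus → ℝ} (hG : ContMDiff torusModel 𝓘(ℝ, ℝ) ∞ G)
    {h : Torus} (hh : ∀ k ∈ fourierSupport G, torusChar k h = 1) (p : Torus) :
    G (p * h) = G p := by
  have h1 := hasSum_torusFourierCoeff hG (p * h)
  have h2 := hasSum_torusFourierCoeff hG p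
  have h3 := h1.unique (h2.congr_fun fun k => ?_)
  · exact_mod_cast h3
  · by_cases hk : torusFourierCoeff G k = 0
    · simp [hk]
    · rw [torusChar_mul, hh k hk, mul_one]

lemma closure_fourierSupport_eq_top_of_injective {α β : ℝ} {G : Torus → ℝ}
    (hG : ContMDiff torusModel 𝓘(ℝ, ℝ) ∞ G) {τ : ℝ} {N : ℕ}
    (hinj : Function.Injective (takensMap (windingFlow α β) G τ N)) :
    AddSubgroup.closure (fourierSupport G) = ⊤ := by
  by_contra hne
  obtain ⟨h, h1, hh⟩ := exists_torusChar_eq_one hne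
  refine h1 (hinj ?_)
  have key (t : ℝ) : windingFlow α β t h = windingFlow α β t 1 * h := by
    simp [windingFlow, Prod.ext_iff, mul_comm]
  simp only [takensMap, key,
    apply_mul_eq_of_torusChar_eq_one hG fun k hk => hh k (AddSubgroup.subset_closure hk)]

/-! ### Ergodic averages of characters -/

/-- The frequency of a character along the winding. -/
def windingFreq (α β : ℝ) (k : ℤ × ℤ) : ℝ := k.1 * α + k.2 * β

lemma torusChar_windingFlow (α β t : ℝ) (k : ℤ × ℤ) (p : Torus) :
    torusChar k (windingFlow α β t p) = torusChar k p * Circle.exp (t * windingFreq α β k) := by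
  have h : windingFlow α β t p = p * (Circle.exp (α * t), Circle.exp (β * t)) := rfl
  rw [h, torusChar_mul, torusChar_exp, windingFreq]
  congr 2
  ring

lemma windingFreq_sub (α β : ℝ) (k l : ℤ × ℤ) :
    windingFreq α β (k - l) = windingFreq α β k - windingFreq α β l := by
  simp only [windingFreq, Prod.fst_sub, Prod.snd_sub, Int.cast_sub]
  ring

lemma windingFreq_ne_zero {α β : ℝ} (hαβ : Irrational (α / β)) {k : ℤ × ℤ} (hk : k ≠ 0) :
    windingFreq α β k ≠ 0 := by
  -- `α / 0 = 0` is rational, so irrationality already excludes `β = 0`.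
  have hβ : β ≠ 0 := by
    rintro rfl
    simp at hαβ
  intro h
  have h2 : (k.1 : ℝ) * (α / β) + k.2 = 0 := by
    rw [windingFreq] at h
    field_simp
    linarith
  by_cases h1 : k.1 = 0
  · refine hk (Prod.ext h1 ?_)
    simpa [h1] using h2
  · have := ((hαβ.intCast_mul h1).add_intCast k.2).ne_zero
    exact this h2

/-- Resonant times have the form `2πn / ω_k`, a countable set, so its complement is dense. -/
lemma exists_nonresonant_time {α β : ℝ} (hαβ : Irrational (α / β)) :
    ∃ τ : ℝ, 0 < τ ∧ ∀ k : ℤ × ℤ, k ≠ 0 → Circle.exp (τ * windingFreq α β k) ≠ 1 := by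
  have hc : (Set.range fun x : (ℤ × ℤ) × ℤ =>
      x.2 * (2 * Real.pi) / windingFreq α β x.1).Countable := Set.countable_range _
  obtain ⟨τ, hτ, hτ0⟩ := (hc.dense_compl ℝ).exists_mem_open (isOpen_Ioi (a := (0 : ℝ)))
    ⟨1, Set.mem_Ioi.2 one_pos⟩
  refine ⟨τ, hτ0, fun k hk h => hτ ?_⟩
  obtain ⟨n, hn⟩ := Circle.exp_eq_one.1 h
  exact ⟨(k, n), by rw [div_eq_iff (windingFreq_ne_zero hαβ hk), hn]⟩

/-- The average of the first `N + 1` powers of a point of the circle. -/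
noncomputable def powerAverage (N : ℕ) (u : Circle) : ℂ :=
  ((N : ℂ) + 1)⁻¹ * ∑ j : Fin (N + 1), (u : ℂ) ^ (j : ℕ)

lemma norm_natCast_add_one_inv (N : ℕ) : ‖((N : ℂ) + 1)⁻¹‖ = ((N : ℝ) + 1)⁻¹ := by
  rw [norm_inv]
  congr 1
  exact_mod_cast Complex.norm_natCast (N + 1)

lemma powerAverage_one (N : ℕ) : powerAverage N 1 = 1 := by
  have : (N : ℂ) + 1 ≠ 0 := by exact_mod_cast N.succ_ne_zero
  simp [powerAverage, this]

lemma norm_powerAverage_le (N : ℕ) (u : Circle) : ‖powerAverage N u‖ ≤ 1 := by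
  rw [powerAverage, norm_mul, norm_natCast_add_one_inv, inv_mul_le_iff₀ (by positivity)]
  refine (norm_sum_le _ _).trans ?_
  simp [Circle.norm_coe]

/-- The geometric sum stays bounded by `2 / ‖u - 1‖` while the divisor grows. -/
lemma tendsto_powerAverage {u : Circle} (hu : u ≠ 1) :
    Tendsto (fun N => powerAverage N u) atTop (𝓝 0) := by
  have hu' : (u : ℂ) ≠ 1 := by rwa [Ne, Circle.coe_eq_one]
  have hu0 : 0 < ‖(u : ℂ) - 1‖ := norm_pos_iff.2 (sub_ne_zero.2 hu')
  have ht : Tendsto (fun N : ℕ => 1 / ((N : ℝ) + 1) * (2 / ‖(u : ℂ) - 1‖)) atTop (𝓝 0) := by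
    simpa using (tendsto_one_div_add_atTop_nhds_zero_nat (𝕜 := ℝ)).mul_const (2 / ‖(u : ℂ) - 1‖)
  refine squeeze_zero_norm (fun N => ?_) ht
  rw [powerAverage, Fin.sum_univ_eq_sum_range fun j => (u : ℂ) ^ j, geom_sum_eq hu', norm_mul,
    norm_natCast_add_one_inv, norm_div, one_div]
  gcongr
  refine (norm_sub_le _ _).trans ?_
  simp [Circle.norm_coe]
  norm_num

/-- The twisted Birkhoff average isolating the Fourier mode `k`. -/
noncomputable def twistedAverage (α β : ℝ) (G : Torus → ℝ) (τ : ℝ) (N : ℕ) (k : ℤ × ℤ)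
    (p : Torus) : ℂ :=
  ((N : ℂ) + 1)⁻¹ * ∑ j : Fin (N + 1),
    ((Circle.exp (τ * windingFreq α β k))⁻¹ ^ (j : ℕ) : Circle) *
      (takensMap (windingFlow α β) G τ N p j : ℂ)

/-- The weights are unimodular and averaged, so the constant is 1 whatever `N` is; this lets `N` be
chosen last. -/
lemma dist_twistedAverage_le (α β : ℝ) (G : Torus → ℝ) (τ : ℝ) (N : ℕ) (k : ℤ × ℤ)
    (p q : Torus) :
    ‖twistedAverage α β G τ N k p - twistedAverage α β G τ N k q‖ ≤
      ‖takensMap (windingFlow α β) G τ N p - takensMap (windingFlow α β) G τ N q‖ := by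
  rw [twistedAverage, twistedAverage, ← mul_sub, ← Finset.sum_sub_distrib, norm_mul,
    norm_natCast_add_one_inv, inv_mul_le_iff₀ (by positivity)]
  refine (norm_sum_le_of_le _ fun j _ => ?_).trans_eq (b := ∑ _j : Fin (N + 1),
    ‖takensMap (windingFlow α β) G τ N p - takensMap (windingFlow α β) G τ N q‖) (by simp)
  rw [← mul_sub, norm_mul, Circle.norm_coe, one_mul, ← Complex.ofReal_sub, Complex.norm_real]
  exact PiLp.norm_apply_le (takensMap (windingFlow α β) G τ N p -
    takensMap (windingFlow α β) G τ N q) j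

lemma hasSum_twistedAverage (α β : ℝ) {G : Torus → ℝ} (hG : ContMDiff torusModel 𝓘(ℝ, ℝ) ∞ G)
    (τ : ℝ) (N : ℕ) (k : ℤ × ℤ) (p : Torus) :
    HasSum (fun l => torusFourierCoeff G l * (torusChar l p : ℂ) *
      powerAverage N (Circle.exp (τ * windingFreq α β (l - k))))
      (twistedAverage α β G τ N k p) := by
  have h := (hasSum_sum (s := Finset.univ) fun (j : Fin (N + 1)) _ =>
    (hasSum_torusFourierCoeff hG (windingFlow α β ((j : ℕ) * τ) p)).mul_left
      (((Circle.exp (τ * windingFreq α β k))⁻¹ ^ (j : ℕ) : Circle) : ℂ)).mul_left ((N : ℂ) + 1)⁻¹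
  refine h.congr_fun fun l => ?_
  rw [powerAverage, mul_left_comm, Finset.mul_sum]
  congr 1
  refine Finset.sum_congr rfl fun j _ => ?_
  have : Circle.exp ((j : ℕ) * τ * windingFreq α β l) =
      Circle.exp (τ * windingFreq α β k) ^ (j : ℕ) *
        Circle.exp (τ * windingFreq α β (l - k)) ^ (j : ℕ) := by
    rw [← mul_pow, ← Circle.exp_add, ← Circle.exp_natCast_mul, windingFreq_sub]
    congr 1
    ring
  rw [torusChar_windingFlow, this]
  simp only [Circle.coe_mul, Circle.coe_pow, Circle.coe_inv, inv_pow]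
  have h0 := pow_ne_zero (j : ℕ) (Circle.exp (τ * windingFreq α β k)).coe_ne_zero
  field_simp

/-! ### The Takens map is bi-Lipschitz for generating Fourier support -/

/-- In the difference of twisted averages, mode `k` appears undamped. Every other mode `l`
contributes at most `b N l * dist p q`, so the threshold for `N` does not depend on `p`, `q`. -/
lemma norm_torusFourierCoeff_mul_dist_le (α β : ℝ) {G : Torus → ℝ}
    (hG : ContMDiff torusModel 𝓘(ℝ, ℝ) ∞ G) {τ : ℝ}
    (hτ : ∀ k : ℤ × ℤ, k ≠ 0 → Circle.exp (τ * windingFreq α β k) ≠ 1) (k : ℤ × ℤ)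
    {ε : ℝ} (hε : 0 < ε) :
    ∀ᶠ N in atTop, ∀ p q, ‖torusFourierCoeff G k‖ * dist (torusChar k p) (torusChar k q) ≤
      ‖takensMap (windingFlow α β) G τ N p - takensMap (windingFlow α β) G τ N q‖ +
        ε * dist p q := by
  let a : ℤ × ℤ → ℝ := fun l => (|(l.1 : ℝ)| + |(l.2 : ℝ)|) * ‖torusFourierCoeff G l‖
  let b : ℕ → ℤ × ℤ → ℝ := fun N l => if l = k then 0 else
    a l * ‖powerAverage N (Circle.exp (τ * windingFreq α β (l - k)))‖
  have ha0 (l : ℤ × ℤ) : 0 ≤ a l := by positivity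
  have ha : Summable a := by
    refine Summable.of_nonneg_of_le ha0 (fun l => ?_) (summable_torusFourierCoeff hG)
    refine mul_le_mul_of_nonneg_right ?_ (norm_nonneg _)
    nlinarith [abs_nonneg (l.1 : ℝ), abs_nonneg (l.2 : ℝ),
      mul_nonneg (abs_nonneg (l.1 : ℝ)) (abs_nonneg (l.2 : ℝ))]
  have hb0 (N : ℕ) (l : ℤ × ℤ) : 0 ≤ b N l := by
    simp only [b]
    split_ifs
    exacts [le_rfl, mul_nonneg (ha0 l) (norm_nonneg _)]
  have hba (N : ℕ) (l : ℤ × ℤ) : b N l ≤ a l := by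
    simp only [b]
    split_ifs
    exacts [ha0 l, mul_le_of_le_one_right (ha0 l) (norm_powerAverage_le _ _)]
  have hbs (N : ℕ) : Summable (b N) := Summable.of_nonneg_of_le (hb0 N) (hba N) ha
  -- Dominated convergence for series: each `b N l` tends to 0 by nonresonance of `l - k`, under the
  -- summable bound `a`.
  have hlim : Tendsto (fun N => ∑' l, b N l) atTop (𝓝 0) := by
    have := tendsto_tsum_of_dominated_convergence (𝓕 := atTop) (f := b) (g := fun _ => 0) ha
      (fun l => ?_) (Eventually.of_forall fun N l => by
        rw [Real.norm_of_nonneg (hb0 N l)]; exact hba N l)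
    · simpa using this
    · by_cases hl : l = k
      · simp [b, hl]
      · simpa [b, hl] using
          (tendsto_powerAverage (hτ (l - k) (sub_ne_zero.2 hl))).norm.const_mul (a l)
  filter_upwards [hlim.eventually_le_const hε] with N hN p q
  have hdiff := (hasSum_twistedAverage α β hG τ N k p).sub (hasSum_twistedAverage α β hG τ N k q)
  set f : ℤ × ℤ → ℂ := fun l => torusFourierCoeff G l * (torusChar l p : ℂ) *
      powerAverage N (Circle.exp (τ * windingFreq α β (l - k))) -
    torusFourierCoeff G l * (torusChar l q : ℂ) *
      powerAverage N (Circle.exp (τ * windingFreq α β (l - k))) with hf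
  have hfk : f k = torusFourierCoeff G k * ((torusChar k p : ℂ) - torusChar k q) := by
    simp only [hf, sub_self, windingFreq, Prod.fst_zero, Prod.snd_zero, Int.cast_zero, zero_mul,
      add_zero, mul_zero, Circle.exp_zero, powerAverage_one]
    ring
  have hrest := hdiff.sub (hasSum_ite_eq k (f k))
  have hle : ‖∑' l, (f l - if l = k then f k else 0)‖ ≤ (∑' l, b N l) * dist p q := by
    refine tsum_of_norm_bounded ((hbs N).hasSum.mul_right (dist p q)) fun l => ?_
    by_cases hl : l = k
    · simp [hl, b]
    · have h1 := dist_torusChar_le l p q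
      rw [Circle.dist_eq_norm_sub] at h1
      simp only [hl, if_false, sub_zero, hf, b, a]
      rw [← sub_mul, ← mul_sub, norm_mul, norm_mul]
      calc _ ≤ ‖torusFourierCoeff G l‖ * ((|(l.1 : ℝ)| + |(l.2 : ℝ)|) * dist p q) *
          ‖powerAverage N (Circle.exp (τ * windingFreq α β (l - k)))‖ := by gcongr
        _ = _ := by ring
  rw [hrest.tsum_eq] at hle
  rw [Circle.dist_eq_norm_sub, ← norm_mul, ← hfk]
  calc ‖f k‖ = ‖(twistedAverage α β G τ N k p - twistedAverage α β G τ N k q) -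
        (twistedAverage α β G τ N k p - twistedAverage α β G τ N k q - f k)‖ := by
        rw [sub_sub_cancel]
    _ ≤ _ := (norm_sub_le _ _).trans (add_le_add (dist_twistedAverage_le α β G τ N k p q)
        (hle.trans (mul_le_mul_of_nonneg_right hN dist_nonneg)))

/-- The constant `C` may depend on `k` and `ε` but not on `N`. The induction keeps `ε` general so
that a sum can spend `ε / 2` on each summand. -/
lemma dist_torusChar_le_of_mem_closure (α β : ℝ) {G : Torus → ℝ}
    (hG : ContMDiff torusModel 𝓘(ℝ, ℝ) ∞ G) {τ : ℝ}
    (hτ : ∀ k : ℤ × ℤ, k ≠ 0 → Circle.exp (τ * windingFreq α β k) ≠ 1) {k : ℤ × ℤ}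
    (hk : k ∈ AddSubgroup.closure (fourierSupport G)) {ε : ℝ} (hε : 0 < ε) :
    ∃ C : ℝ, 0 ≤ C ∧ ∀ᶠ N in atTop, ∀ p q, dist (torusChar k p) (torusChar k q) ≤
      C * ‖takensMap (windingFlow α β) G τ N p - takensMap (windingFlow α β) G τ N q‖ +
        ε * dist p q := by
  induction hk using AddSubgroup.closure_induction generalizing ε with
  | mem k hk =>
    have hc : 0 < ‖torusFourierCoeff G k‖ := norm_pos_iff.2 hk
    refine ⟨‖torusFourierCoeff G k‖⁻¹, by positivity, ?_⟩
    -- The error is taken to be `‖Ĝ(k)‖ ε`, so dividing by `‖Ĝ(k)‖` leaves `ε`.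
    filter_upwards [norm_torusFourierCoeff_mul_dist_le α β hG hτ k (mul_pos hc hε)] with N hN p q
    refine le_of_mul_le_mul_left ((hN p q).trans_eq ?_) hc
    field_simp
  | zero => exact ⟨0, le_rfl, Eventually.of_forall fun N p q => by
      simp only [torusChar_zero, dist_self]; positivity⟩
  | add k l _ _ hk hl =>
    obtain ⟨C, hC, h⟩ := hk (half_pos hε)
    obtain ⟨D, hD, h'⟩ := hl (half_pos hε)
    refine ⟨C + D, add_nonneg hC hD, ?_⟩
    filter_upwards [h, h'] with N h1 h2 p q
    rw [torusChar_add, torusChar_add]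
    linarith [Circle.dist_mul_mul_le (torusChar k p) (torusChar l p) (torusChar k q)
      (torusChar l q), h1 p q, h2 p q]
  | neg k _ hk =>
    simpa only [torusChar_neg, Circle.dist_inv_inv] using hk hε

/-- The torus carries the max metric, so the characters `(1, 0)` and `(0, 1)` control it. With `ε =
1/2` the error is absorbed on the left, which doubles the constant. -/
lemma exists_dist_le_mul_norm_takensMap_sub (α β : ℝ) {G : Torus → ℝ}
    (hG : ContMDiff torusModel 𝓘(ℝ, ℝ) ∞ G) {τ : ℝ}
    (hτ : ∀ k : ℤ × ℤ, k ≠ 0 → Circle.exp (τ * windingFreq α β k) ≠ 1)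
    (htop : AddSubgroup.closure (fourierSupport G) = ⊤) :
    ∃ C : ℝ, ∀ᶠ N in atTop, ∀ p q, dist p q ≤
      C * ‖takensMap (windingFlow α β) G τ N p - takensMap (windingFlow α β) G τ N q‖ := by
  obtain ⟨C, hC, h1⟩ := dist_torusChar_le_of_mem_closure α β hG hτ (k := (1, 0)) (by simp [htop])
    one_half_pos
  obtain ⟨D, hD, h2⟩ := dist_torusChar_le_of_mem_closure α β hG hτ (k := (0, 1)) (by simp [htop])
    one_half_pos
  refine ⟨2 * (C + D), ?_⟩
  filter_upwards [h1, h2] with N h1 h2 p q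
  have h1 := h1 p q
  have h2 := h2 p q
  simp only [torusChar, zpow_one, zpow_zero, mul_one, one_mul] at h1 h2
  have hn := norm_nonneg
    (takensMap (windingFlow α β) G τ N p - takensMap (windingFlow α β) G τ N q)
  have hCn := mul_nonneg hC hn
  have hDn := mul_nonneg hD hn
  have : dist p q ≤ (C + D) *
      ‖takensMap (windingFlow α β) G τ N p - takensMap (windingFlow α β) G τ N q‖ +
      1 / 2 * dist p q := max_le (by linarith) (by linarith)
  linarith

/-! ### From the bi-Lipschitz estimate to an embedding -/

/-- If `L v = 0`, then `f (x + t v) - f x = o(t)`, against the lower bound. -/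
lemma fderiv_injective_of_eventually_norm_le {E F : Type*} [NormedAddCommGroup E]
    [NormedSpace ℝ E] [NormedAddCommGroup F] [NormedSpace ℝ F] {f : E → F} {L : E →L[ℝ] F} {x : E}
    (hf : HasFDerivAt f L x) {C : ℝ} (h : ∀ᶠ y in 𝓝 x, ‖y - x‖ ≤ C * ‖f y - f x‖) :
    Function.Injective L := by
  refine (injective_iff_map_eq_zero L).2 fun v hv => ?_
  by_contra hv0
  have hC : 0 < |C| + 1 := by positivity
  -- This constant forces `‖t • v‖ ≤ ‖t • v‖ / 2`; `|C| + 1` is positive whatever the sign of `C`.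
  have hlittle := hf.isLittleO.def (c := (2 * (|C| + 1))⁻¹) (by positivity)
  have htend : Tendsto (fun t : ℝ => x + t • v) (𝓝[≠] 0) (𝓝 x) := by
    have : Continuous fun t : ℝ => x + t • v := by fun_prop
    simpa using (this.tendsto 0).mono_left nhdsWithin_le_nhds
  obtain ⟨t, ⟨ht1, ht2⟩, ht0⟩ := ((htend.eventually (h.and hlittle)).and
    self_mem_nhdsWithin).exists
  have hpos : 0 < ‖t • v‖ := norm_pos_iff.2 (smul_ne_zero ht0 hv0)
  simp only [add_sub_cancel_left, map_smul, hv, smul_zero, sub_zero] at ht1 ht2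
  have h3 : C * ‖f (x + t • v) - f x‖ ≤ (|C| + 1) * ‖f (x + t • v) - f x‖ := by
    gcongr
    linarith [le_abs_self C]
  have h4 : (|C| + 1) * ‖f (x + t • v) - f x‖ ≤ (|C| + 1) * ((2 * (|C| + 1))⁻¹ * ‖t • v‖) := by
    gcongr
  have h5 : (|C| + 1) * ((2 * (|C| + 1))⁻¹ * ‖t • v‖) = ‖t • v‖ / 2 := by field_simp
  linarith

/-- Equal dimensions make the injective `A` surjective. This avoids computing the derivative of
`torusExp`. -/
lemma LinearMap.injective_of_injective_comp_of_finrank_eq {K V W E : Type*} [Field K]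
    [AddCommGroup V] [Module K V] [AddCommGroup W] [Module K W] [AddCommGroup E] [Module K E]
    [FiniteDimensional K V] [FiniteDimensional K W]
    (hVW : Module.finrank K V = Module.finrank K W) (B : W →ₗ[K] E) (A : V →ₗ[K] W)
    (h : Function.Injective (B ∘ₗ A)) : Function.Injective B := by
  have hA : Function.Injective A := Function.Injective.of_comp (f := B) h
  have hA' := (LinearMap.injective_iff_surjective_of_finrank_eq_finrank hVW).1 hA
  intro x y hxy
  obtain ⟨x, rfl⟩ := hA' x
  obtain ⟨y, rfl⟩ := hA' y
  exact congrArg A (h hxy)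

/-- The chord has length `2 |sin (s / 2)|`; Jordan's inequality compares it with the arc. -/
lemma abs_le_mul_dist_exp {s : ℝ} (hs : |s| ≤ Real.pi) (z : Circle) :
    |s| ≤ Real.pi / 2 * dist (z * Circle.exp s) z := by
  have h1 : dist (z * Circle.exp s) z = 2 * |Real.sin (s / 2)| := by
    conv_lhs => rw [← mul_one z, mul_assoc, Circle.dist_mul_left, one_mul]
    rw [Circle.dist_eq_norm_sub, Circle.coe_exp, mul_comm, Circle.coe_one,
      Complex.norm_exp_I_mul_ofReal_sub_one]
    simp
  have h2 := Real.mul_abs_le_abs_sin (x := s / 2) (by rw [abs_div, abs_two]; linarith)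
  rw [h1]
  rw [abs_div, abs_two] at h2
  have hpi := Real.pi_pos
  calc |s| = Real.pi / 2 * (2 * (2 / Real.pi * (|s| / 2))) := by field_simp
    _ ≤ _ := by gcongr

lemma torusExp_zero (p : Torus) : torusExp p 0 = p := by simp [torusExp]

lemma norm_le_mul_dist_torusExp (p : Torus) {w : ℝ × ℝ} (hw : ‖w‖ ≤ Real.pi) :
    ‖w‖ ≤ Real.pi / 2 * dist (torusExp p w) p := by
  have hpi := Real.pi_pos
  refine max_le ?_ ?_
  · refine (abs_le_mul_dist_exp ((norm_fst_le w).trans hw) p.1).trans ?_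
    gcongr
    exact le_max_left _ _
  · refine (abs_le_mul_dist_exp ((norm_snd_le w).trans hw) p.2).trans ?_
    gcongr
    exact le_max_right _ _

/-- Pulling back along `torusExp p` reduces the claim to a map on `ℝ × ℝ`, where the lower bound
holds near `0` with constant `π / 2 * C`. -/
lemma mfderiv_injective_of_dist_le {E : Type*} [NormedAddCommGroup E] [NormedSpace ℝ E]
    {Φ : Torus → E} (hΦ : ContMDiff torusModel 𝓘(ℝ, E) ∞ Φ) {C : ℝ}
    (h : ∀ p q, dist p q ≤ C * ‖Φ p - Φ q‖) (p : Torus) :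
    Function.Injective (mfderiv torusModel 𝓘(ℝ, E) Φ p) := by
  suffices hs : Function.Injective (mfderiv torusModel 𝓘(ℝ, E) Φ (torusExp p 0)) by
    rwa [torusExp_zero] at hs
  have h1 : MDifferentiableAt torusModel 𝓘(ℝ, E) Φ (torusExp p 0) :=
    hΦ.mdifferentiable (by simp) _
  have h2 : MDifferentiableAt 𝓘(ℝ, ℝ × ℝ) torusModel (torusExp p) 0 :=
    (contMDiff_torusExp p).mdifferentiable (by simp) _
  have hcomp : HasFDerivAt (Φ ∘ torusExp p)
      ((mfderiv torusModel 𝓘(ℝ, E) Φ (torusExp p 0)).comp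
        (mfderiv 𝓘(ℝ, ℝ × ℝ) torusModel (torusExp p) 0)) (0 : ℝ × ℝ) :=
    (h1.hasMFDerivAt.comp (0 : ℝ × ℝ) h2.hasMFDerivAt).hasFDerivAt
  have hinj := fderiv_injective_of_eventually_norm_le hcomp (C := Real.pi / 2 * C) (by
    filter_upwards [Metric.closedBall_mem_nhds (0 : ℝ × ℝ) Real.pi_pos] with w hw
    rw [mem_closedBall_zero_iff] at hw
    have hpi := Real.pi_pos
    rw [sub_zero, mul_assoc]
    refine (norm_le_mul_dist_torusExp p hw).trans ?_
    gcongr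
    simpa [torusExp_zero] using h (torusExp p w) p)
  -- The tangent spaces are unfolded to their model spaces so that dimensions can be compared.
  let B : EuclideanSpace ℝ (Fin 1) × EuclideanSpace ℝ (Fin 1) →L[ℝ] E :=
    mfderiv torusModel 𝓘(ℝ, E) Φ (torusExp p 0)
  let A : ℝ × ℝ →L[ℝ] EuclideanSpace ℝ (Fin 1) × EuclideanSpace ℝ (Fin 1) :=
    mfderiv 𝓘(ℝ, ℝ × ℝ) torusModel (torusExp p) 0
  exact LinearMap.injective_of_injective_comp_of_finrank_eq (by simp) B.toLinearMap
    A.toLinearMap hinj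

lemma contMDiff_windingFlow (α β t : ℝ) :
    ContMDiff torusModel torusModel ∞ (windingFlow α β t) :=
  ((contMDiff_id.mul contMDiff_const).comp contMDiff_fst).prodMk
    ((contMDiff_id.mul contMDiff_const).comp contMDiff_snd)

lemma contMDiff_takensMap_windingFlow (α β : ℝ) {G : Torus → ℝ}
    (hG : ContMDiff torusModel 𝓘(ℝ, ℝ) ∞ G) (τ : ℝ) (N : ℕ) :
    ContMDiff torusModel 𝓘(ℝ, EuclideanSpace ℝ (Fin (N + 1))) ∞
      (takensMap (windingFlow α β) G τ N) := by
  have h : ContMDiff torusModel 𝓘(ℝ, Fin (N + 1) → ℝ) ∞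
      fun p (j : Fin (N + 1)) => G (windingFlow α β ((j : ℕ) * τ) p) :=
    contMDiff_pi_space.2 fun j => hG.comp (contMDiff_windingFlow α β _)
  exact (EuclideanSpace.equiv (Fin (N + 1)) ℝ).symm.contDiff.contMDiff.comp h

lemma isSmoothEmb_of_dist_le {E : Type*} [NormedAddCommGroup E] [NormedSpace ℝ E]
    {Φ : Torus → E} (hΦ : ContMDiff torusModel 𝓘(ℝ, E) ∞ Φ) {C : ℝ}
    (h : ∀ p q, dist p q ≤ C * ‖Φ p - Φ q‖) : IsSmoothEmb torusModel 𝓘(ℝ, E) Φ where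
  contMDiff := hΦ
  injective_mfderiv := mfderiv_injective_of_dist_le hΦ h
  isEmbedding := by
    refine (hΦ.continuous.isClosedEmbedding fun p q hpq => ?_).isEmbedding
    have := h p q
    rw [hpq, sub_self, norm_zero, mul_zero] at this
    exact dist_le_zero.1 this

theorem theorem2 (α β : ℝ) (hαβ : Irrational (α / β)) (G : Torus → ℝ)
    (hG : ContMDiff torusModel 𝓘(ℝ, ℝ) ∞ G) :
    IsGoodObservation torusModel (windingFlow α β) G ↔
      AddSubgroup.closure (fourierSupport G) = ⊤ := by
  constructor
  · rintro ⟨N, τ, -, -, hemb⟩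
    exact closure_fourierSupport_eq_top_of_injective hG hemb.isEmbedding.injective
  · intro htop
    obtain ⟨τ, hτ0, hτ⟩ := exists_nonresonant_time hαβ
    obtain ⟨C, hC⟩ := exists_dist_le_mul_norm_takensMap_sub α β hG hτ htop
    obtain ⟨N, hN, hN0⟩ := (hC.and (eventually_gt_atTop 0)).exists
    exact ⟨N, τ, hN0, hτ0,
      isSmoothEmb_of_dist_le (contMDiff_takensMap_windingFlow α β hG τ N) hN⟩
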